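/- Let $0<\alpha\le 2$, $\kappa>0$ and $\lambda\in\mathbb R$. Let $X_1,X_2,\dots$ be i.i.d. real random variables such that $$n^{-1/\alpha}\sum_{i=1}^n X_i \xrightarrow{d} Z \qquad (n\to\infty),$$ where $Z$ is an $\alpha$-stable random variable with characteristic function $$\varphi_Z(t)=\exp\bigl(-(\kappa-\mathrm i\lambda)t^\alpha\bigr),\qquad t\ge 0 .$$ Let $Y\ge 0$ be a random variable with $\mathbb E Y^\alpha<\infty$, and let $Y_1,Y_2,\dots$ be independent copies of $Y$ such that the sequence $(Y_i)_{i\ge1}$ is independent of the sequence $(X_i)_{i\ge1}$. Then $$n^{-1/\alpha}\sum_{i=1}^n X_iY_i \xrightarrow{d} Z' := \bigl(\mathbb E Y^\alpha\bigr)^{1/\alpha} Z ,$$ and $Z'$ has the characteristic function $$\varphi_{Z'}(t)=\exp\bigl(-(\mathbb E Y^\alpha\,\kappa-\mathrm i\,\mathbb E Y^\alpha\,\lambda)\,t^\alpha\bigr),\qquad t\ge 0 .$$ For $-1\le\beta\le1$, $\gamma\ge 0$ and $\delta\in\mathbb R$, let $S_\alpha(\gamma,\beta,\delta)$ denote the distribution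 with characteristic function $$\varphi(t)=\begin{cases}\exp\bigl(-\gamma^\alpha|t|^\alpha\bigl(1-\mathrm i\beta\tan\tfrac{\pi\alpha}{2}\,\operatorname{sgn}(t)\bigr)+\mathrm i\delta t\bigr), & \alpha\ne1,\\[2pt] \exp\bigl(-\gamma|t|\bigl(1+\mathrm i\beta\tfrac2\pi\operatorname{sgn}(t)\log|t|\bigr)+\mathrm i\delta t\bigr), & \alpha=1\end{cases}$$ (for $\gamma=0$ this is the point mass at $\delta$). If $Z\sim S_\alpha(\gamma,\beta,0)$, where $\beta=0$ if $\alpha=1$, then $Z'\sim S_\alpha\bigl((\mathbb E Y^\alpha)^{1/\alpha}\gamma,\beta,0\bigr)$. -/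

import Mathlib

open MeasureTheory ProbabilityTheory Filter Topology

/-- The function `t ↦ exp(-γ^α |t|^α (1 - i β tan(πα/2) sgn t) + i δ t)` for `α ≠ 1`, and
`t ↦ exp(-γ |t| (1 + i β (2/π) sgn t log |t|) + i δ t)` for `α = 1`. -/
noncomputable def stableCharFun (α γ β δ t : ℝ) : ℂ :=
  if α = 1 then
    Complex.exp (-((γ * |t| : ℝ) : ℂ) *
        (1 + Complex.I * ((β * (2 / Real.pi) * Real.sign t * Real.log |t| : ℝ) : ℂ))
      + Complex.I * ((δ * t : ℝ) : ℂ))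
  else
    Complex.exp (-((γ ^ α * |t| ^ α : ℝ) : ℂ) *
        (1 - Complex.I * ((β * Real.tan (Real.pi * α / 2) * Real.sign t : ℝ) : ℂ))
      + Complex.I * ((δ * t : ℝ) : ℂ))

/-- The law `ν` on `ℝ` is the stable distribution `S_α(γ, β, δ)`. The scale `γ = 0` is admitted and
gives, by convention, the point mass at `δ`. -/
structure IsStableLaw (α γ β δ : ℝ) (ν : Measure ℝ) : Prop where
  isProbabilityMeasure : IsProbabilityMeasure ν
  index_pos : 0 < α
  index_le_two : α ≤ 2
  scale_nonneg : 0 ≤ γ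
  neg_one_le_skewness : -1 ≤ β
  skewness_le_one : β ≤ 1
  charFun_eq : ∀ t : ℝ, charFun ν t = stableCharFun α γ β δ t

/-- The law `ν` has characteristic function `exp(-(κ - i lam) t^α)` for `t ≥ 0`. -/
def HasStrictlyStableCharFun (α κ lam : ℝ) (ν : Measure ℝ) : Prop :=
  ∀ t : ℝ, 0 ≤ t →
    charFun ν t = Complex.exp (-((κ : ℂ) - Complex.I * (lam : ℂ)) * ((t ^ α : ℝ) : ℂ))

/-!
Let `φ` be the characteristic function of `X 0` and `c = κ - i lam`. The whole argument rests on the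
expansion `φ s = 1 - c s ^ α + o(s ^ α)` as `s ↓ 0`, which the assumed limit theorem for the `X i`
forces.

That theorem gives `φ (n ^ (-1/α) s) ^ n → exp (-c s ^ α)`, and Slutsky's theorem with the scale `s`
allowed to vary makes the convergence uniform for `s ∈ [0, 1]`
(`MeasureTheory.TendstoInDistribution.tendsto_charFun_prod`). To take logarithms one has to exclude
jumps by multiples of `2πi`: the function `n log φ (n ^ (-1/α) s) + c s ^ α` is continuous on
`[0, 1]`, vanishes at `0`, and has an exponential uniformly close to `1`, so it is itself uniformly
small (`norm_le_two_mul_of_norm_exp_sub_one_le`). Choosing `n = ⌊s ^ (-α)⌋` for a given small `s`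
turns this into `log φ s / s ^ α → -c` (`tendsto_log_div_rpow_of_tendsto_pow`), which is equivalent
to the expansion.

Conditioning on the `Ys i` shows that the characteristic function of `∑ i < n, X i * Ys i` at `t` is
`(E φ (t Y)) ^ n` (`ProbabilityTheory.IndepFun.charFun_sum_mul`). By the expansion,
`n (φ (n ^ (-1/α) t Y) - 1) → -c t ^ α Y ^ α` pointwise, and `‖φ s - 1‖ ≤ C s ^ α` for all `s ≥ 0`,
so the integrable variable `Y ^ α` yields a dominating function. Hence
`(E φ (n ^ (-1/α) t Y)) ^ n → exp (-c t ^ α E Y ^ α)`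
(`tendsto_pow_integral_of_tendsto_sub_one_div`), and Lévy's convergence theorem concludes. The
statements on the law of `Z'` are the scaling of characteristic functions.
-/

/-! ### Characteristic functions -/

/-- A continuous branch starting at `0` is controlled by its exponential: it cannot reach norm `1/2`,
where `‖exp z - 1‖ ≥ 1/4`, hence stays where `exp` is comparable to its linearization. -/
lemma norm_le_two_mul_of_norm_exp_sub_one_le {f : ℝ → ℂ} {ε : ℝ} (hε : ε < 1 / 4)
    (hf : ContinuousOn f (Set.Icc 0 1)) (h0 : f 0 = 0)
    (h : ∀ s ∈ Set.Icc (0 : ℝ) 1, ‖Complex.exp (f s) - 1‖ ≤ ε) {s : ℝ}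
    (hs : s ∈ Set.Icc (0 : ℝ) 1) : ‖f s‖ ≤ 2 * ε := by
  -- On this disc `‖exp z - 1 - z‖ ≤ ‖z‖ ^ 2 ≤ ‖z‖ / 2`.
  have key : ∀ z : ℂ, ‖z‖ ≤ 1 / 2 → ‖z‖ ≤ 2 * ‖Complex.exp z - 1‖ := fun z hz ↦ by
    have h1 := Complex.norm_exp_sub_one_sub_id_le (x := z) (by linarith)
    have h2 : ‖z‖ ≤ ‖Complex.exp z - 1‖ + ‖Complex.exp z - 1 - z‖ := by
      simpa using norm_sub_le (Complex.exp z - 1) (Complex.exp z - 1 - z)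
    nlinarith [norm_nonneg z]
  have hlt : ‖f s‖ < 1 / 2 := by
    by_contra! hge
    obtain ⟨r, hr, hr'⟩ := isPreconnected_Icc.intermediate_value
      (Set.left_mem_Icc.2 zero_le_one) hs hf.norm
      (show (1 / 2 : ℝ) ∈ Set.Icc ‖f 0‖ ‖f s‖ from ⟨by simp [h0], hge⟩)
    have := key (f r) hr'.le
    have := h r hr
    simp only at hr'
    linarith
  have := key (f s) hlt.le
  have := h s hs
  linarith

lemma MeasureTheory.TendstoInDistribution.tendsto_charFun {ι Ω Ω' : Type*} [MeasurableSpace Ω]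
    [MeasurableSpace Ω'] {P : Measure Ω} [IsProbabilityMeasure P] {P' : Measure Ω'}
    [IsProbabilityMeasure P'] {S : ι → Ω → ℝ} {Z : Ω' → ℝ} {l : Filter ι}
    (h : TendstoInDistribution S l Z (fun _ ↦ P) P') (t : ℝ) :
    Tendsto (fun i ↦ charFun (P.map (S i)) t) l (𝓝 (charFun (P'.map Z) t)) := by
  have h' := (ProbabilityMeasure.tendsto_iff_forall_integral_rclike_tendsto ℂ).1 h.tendsto
  simp_rw [charFun_eq_integral_innerProbChar]
  exact h' (BoundedContinuousFunction.innerProbChar t)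

/-- Convergence in distribution gives joint (hence locally uniform) convergence of characteristic
functions. The proof applies Slutsky's theorem along the product filter, to the random scale that is
constantly `s` at the index `(i, s)`. -/
lemma MeasureTheory.TendstoInDistribution.tendsto_charFun_prod {ι Ω Ω' : Type*} [MeasurableSpace Ω]
    [MeasurableSpace Ω'] {P : Measure Ω} [IsProbabilityMeasure P] {P' : Measure Ω'}
    [IsProbabilityMeasure P'] {S : ι → Ω → ℝ} {Z : Ω' → ℝ} {l : Filter ι}
    [l.IsCountablyGenerated]
    (h : TendstoInDistribution S l Z (fun _ ↦ P) P') (t : ℝ) :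
    Tendsto (fun p : ι × ℝ ↦ charFun (P.map (S p.1)) p.2) (l ×ˢ 𝓝 t)
      (𝓝 (charFun (P'.map Z) t)) := by
  have h1 : TendstoInDistribution (fun p : ι × ℝ ↦ S p.1) (l ×ˢ 𝓝 t) Z (fun _ ↦ P) P' :=
    ⟨fun p ↦ h.forall_aemeasurable p.1, h.aemeasurable_limit, h.tendsto.comp tendsto_fst⟩
  have h2 : TendstoInMeasure P (fun (p : ι × ℝ) (_ : Ω) ↦ p.2) (l ×ˢ 𝓝 t) (fun _ ↦ t) := by
    rw [tendstoInMeasure_iff_dist]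
    intro ε hε
    refine tendsto_const_nhds.congr' ?_
    filter_upwards [tendsto_snd.eventually (Metric.ball_mem_nhds t hε)] with p hp
    have hp' : ¬ ε ≤ dist p.2 t := not_le.2 hp
    simp [hp']
  have h3 := (h1.continuous_comp_prodMk_of_tendstoInMeasure_const
    (g := fun p : ℝ × ℝ ↦ p.2 * p.1) (by fun_prop) h2
    (fun _ ↦ aemeasurable_const)).tendsto_charFun 1
  have e1 : ∀ p : ι × ℝ, charFun (P.map (fun ω ↦ p.2 * S p.1 ω)) 1
      = charFun (P.map (S p.1)) p.2 := fun p ↦ by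
    rw [charFun_map_mul_comp (h.forall_aemeasurable p.1), mul_one]
  rw [charFun_map_mul_comp h.aemeasurable_limit, mul_one] at h3
  exact h3.congr e1

/-- Given the `Y i`, the sum `∑ X i * Y i` is a sum of independent variables, so its characteristic
function is a product; integrating over the independent `Y i` keeps the product form. -/
lemma ProbabilityTheory.IndepFun.charFun_sum_mul {Ω : Type*} [MeasurableSpace Ω] {P : Measure Ω}
    [IsProbabilityMeasure P] {X Y : ℕ → Ω → ℝ} (hX : iIndepFun X P) (hY : iIndepFun Y P)
    (mX : ∀ i, AEMeasurable (X i) P) (mY : ∀ i, AEMeasurable (Y i) P)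
    (hXY : IndepFun (fun ω i ↦ X i ω) (fun ω i ↦ Y i ω) P) (n : ℕ) (t : ℝ) :
    charFun (P.map fun ω ↦ ∑ i ∈ Finset.range n, X i ω * Y i ω) t
      = ∏ i ∈ Finset.range n, ∫ y, charFun (P.map (X i)) (t * y) ∂(P.map (Y i)) := by
  have hpX (i) : IsProbabilityMeasure (P.map (X i)) := Measure.isProbabilityMeasure_map (mX i)
  have hpY (i) : IsProbabilityMeasure (P.map (Y i)) := Measure.isProbabilityMeasure_map (mY i)
  have hr : Measurable fun (x : ℕ → ℝ) (i : Fin n) ↦ x i := by fun_prop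
  -- The pair is taken with the `Y i` first, so that the iterated integral has the `X i` inside.
  have hind : IndepFun (fun ω (i : Fin n) ↦ Y i ω) (fun ω (i : Fin n) ↦ X i ω) P :=
    (hXY.comp hr hr).symm
  have mX' : AEMeasurable (fun ω (i : Fin n) ↦ X i ω) P := aemeasurable_pi_lambda _ fun i ↦ mX i
  have mY' : AEMeasurable (fun ω (i : Fin n) ↦ Y i ω) P := aemeasurable_pi_lambda _ fun i ↦ mY i
  have hlaw := hind.map_prod_eq_prod_map_map mY' mX'
  rw [iIndepFun.map_fun_eq_pi_map (fun i : Fin n ↦ mX i) (hX.precomp Fin.val_injective),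
    iIndepFun.map_fun_eq_pi_map (fun i : Fin n ↦ mY i) (hY.precomp Fin.val_injective)] at hlaw
  have hsum : (fun ω ↦ ∑ i ∈ Finset.range n, X i ω * Y i ω)
      = (fun p : (Fin n → ℝ) × (Fin n → ℝ) ↦ ∑ i, p.2 i * p.1 i) ∘
        fun ω ↦ (fun i : Fin n ↦ Y i ω, fun i : Fin n ↦ X i ω) := by
    ext ω
    simp [Finset.sum_range]
  rw [hsum, ← AEMeasurable.map_map_of_aemeasurable (by fun_prop) (mY'.prodMk mX'), hlaw,
    charFun_apply_real, integral_map (by fun_prop) (by fun_prop), integral_prod]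
  · have inner : ∀ y : Fin n → ℝ,
        ∫ x, Complex.exp (t * ((∑ i, x i * y i : ℝ) : ℂ) * Complex.I)
          ∂(Measure.pi fun i : Fin n ↦ P.map (X i))
        = ∏ i : Fin n, charFun (P.map (X i)) (t * y i) := fun y ↦ by
      simp_rw [charFun_apply_real]
      rw [← integral_fintype_prod_eq_prod]
      congr with x
      rw [← Complex.exp_sum]
      congr 1
      push_cast
      rw [Finset.mul_sum, Finset.sum_mul]
      exact Finset.sum_congr rfl fun i _ ↦ by ring
    simp_rw [inner]
    rw [integral_fintype_prod_eq_prod (fun (i : Fin n) y ↦ charFun (P.map (X i)) (t * y)),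
      Finset.prod_range]
  · refine Integrable.of_bound (C := 1) (Measurable.aestronglyMeasurable (by fun_prop))
      (ae_of_all _ fun p ↦ ?_)
    rw [← Complex.ofReal_mul, Complex.norm_exp_ofReal_mul_I]

/-! ### Expansion of the characteristic function at the origin -/

/-- If the powers `φ (n ^ (-1/α) s) ^ n` converge, jointly in `n` and `s`, to the strictly stable
characteristic function `exp (-c s ^ α)`, then `log φ s` is asymptotic to `-c s ^ α` along *all*
`s ↓ 0`, with the principal branch of the logarithm. -/
lemma tendsto_log_div_rpow_of_tendsto_pow {φ : ℝ → ℂ} (hφ : Continuous φ) (hφ0 : φ 0 = 1)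
    {α : ℝ} (hα : 0 < α) {c : ℂ}
    (h : ∀ t : ℝ, 0 ≤ t → Tendsto (fun q : ℕ × ℝ ↦ φ ((q.1 : ℝ) ^ (-(1 / α)) * q.2) ^ q.1)
      (atTop ×ˢ 𝓝 t) (𝓝 (Complex.exp (-c * ((t ^ α : ℝ) : ℂ))))) :
    Tendsto (fun s ↦ Complex.log (φ s) / ((s ^ α : ℝ) : ℂ)) (𝓝[>] 0) (𝓝 (-c)) := by
  have hcont : Continuous fun s : ℝ ↦ s ^ α := Real.continuous_rpow_const hα.le
  have hunif : TendstoUniformlyOn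
      (fun (n : ℕ) (s : ℝ) ↦ φ ((n : ℝ) ^ (-(1 / α)) * s) ^ n * Complex.exp (c * ((s ^ α : ℝ) : ℂ)))
      (fun _ ↦ 1) atTop (Set.Icc 0 1) := by
    rw [← tendstoLocallyUniformlyOn_iff_tendstoUniformlyOn_of_compact isCompact_Icc,
      tendstoLocallyUniformlyOn_iff_forall_tendsto]
    intro t ht
    have hexp : Tendsto (fun q : ℕ × ℝ ↦ Complex.exp (c * ((q.2 ^ α : ℝ) : ℂ))) (atTop ×ˢ 𝓝 t)
        (𝓝 (Complex.exp (c * ((t ^ α : ℝ) : ℂ)))) :=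
      (Continuous.tendsto (f := fun s : ℝ ↦ Complex.exp (c * ((s ^ α : ℝ) : ℂ)))
        (by fun_prop) t).comp tendsto_snd
    have hmul := (h t ht.1).mul hexp
    rw [← Complex.exp_add, neg_mul, neg_add_cancel, Complex.exp_zero] at hmul
    exact tendsto_const_nhds.prodMk_nhds hmul |>.mono_right (nhds_le_uniformity (1 : ℂ)) |>.mono_left
      (Filter.prod_mono le_rfl nhdsWithin_le_nhds)
  have hslit : ∀ᶠ s in 𝓝 (0 : ℝ), φ s ∈ Complex.slitPlane :=
    hφ.continuousAt.eventually_mem (Complex.isOpen_slitPlane.mem_nhds (by simp [hφ0]))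
  obtain ⟨δ, hδ, hball⟩ := Metric.eventually_nhds_iff.1 hslit
  have hsmall : Tendsto (fun n : ℕ ↦ (n : ℝ) ^ (-(1 / α))) atTop (𝓝 0) :=
    (tendsto_rpow_neg_atTop (by positivity)).comp tendsto_natCast_atTop_atTop
  -- No multiple of `2πi` can appear: the left-hand side is continuous in `s` and vanishes at `0`.
  have hlog : ∀ ε : ℝ, 0 < ε → ε < 1 / 4 → ∀ᶠ n : ℕ in atTop, ∀ s ∈ Set.Icc (0 : ℝ) 1,
      ‖n * Complex.log (φ ((n : ℝ) ^ (-(1 / α)) * s)) + c * ((s ^ α : ℝ) : ℂ)‖ ≤ 2 * ε := by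
    intro ε hε hε4
    filter_upwards [Metric.tendstoUniformlyOn_iff.1 hunif ε hε, hsmall.eventually_lt_const hδ]
      with n hn hnδ
    have hmem : ∀ s ∈ Set.Icc (0 : ℝ) 1, φ ((n : ℝ) ^ (-(1 / α)) * s) ∈ Complex.slitPlane := by
      intro s hs
      apply hball
      have h0 : 0 ≤ (n : ℝ) ^ (-(1 / α)) := by positivity
      rw [Real.dist_eq, sub_zero, abs_of_nonneg (mul_nonneg h0 hs.1)]
      exact (mul_le_of_le_one_right h0 hs.2).trans_lt hnδ
    intro s hs
    refine norm_le_two_mul_of_norm_exp_sub_one_le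
      (f := fun s ↦ n * Complex.log (φ ((n : ℝ) ^ (-(1 / α)) * s)) + c * ((s ^ α : ℝ) : ℂ))
      hε4 ?_ ?_ ?_ hs
    · refine .add (.mul continuousOn_const (.clog (by fun_prop) hmem)) (by fun_prop)
    · simp [hφ0, Real.zero_rpow hα.ne']
    · intro r hr
      rw [Complex.exp_add, Complex.exp_nat_mul,
        Complex.exp_log (Complex.slitPlane_ne_zero (hmem r hr)), ← dist_eq_norm, dist_comm]
      exact (hn r hr).le
  rw [Metric.tendsto_nhds]
  intro ε hε
  -- For `n = ⌊s ^ (-α)⌋` the point `r = s * n ^ (1 / α)` lies in `[0, 1]`, satisfies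
  -- `n ^ (-1 / α) * r = s`, and `n * s ^ α = r ^ α` is at least `1 / 2`.
  have hpow : Tendsto (fun s : ℝ ↦ s ^ (-α)) (𝓝[>] 0) atTop :=
    tendsto_rpow_neg_nhdsGT_zero (neg_lt_zero.2 hα)
  have hfloor : Tendsto (fun s : ℝ ↦ ⌊s ^ (-α)⌋₊) (𝓝[>] 0) atTop :=
    tendsto_nat_floor_atTop.comp hpow
  -- The second entry meets the threshold of `hlog`; with the first, division by `n * s ^ α ≥ 1 / 2`
  -- leaves at most `ε / 2`.
  have hε' : 0 < min (ε / 8) (1 / 8) := by positivity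
  filter_upwards [hfloor.eventually (hlog _ hε' ((min_le_right _ _).trans_lt (by norm_num))),
    hfloor.eventually_ge_atTop 1, self_mem_nhdsWithin] with s hs hn1 (hs0 : 0 < s)
  have hle := Nat.floor_le (by positivity : 0 ≤ s ^ (-α))
  have hlt := Nat.lt_floor_add_one (s ^ (-α))
  generalize ⌊s ^ (-α)⌋₊ = n at hs hn1 hle hlt
  have hn1' : (1 : ℝ) ≤ n := by exact_mod_cast hn1
  have hn0 : (0 : ℝ) < n := by linarith
  have hsα : 0 < s ^ α := by positivity
  have hinv : s ^ (-α) * s ^ α = 1 := by rw [← Real.rpow_add hs0]; simp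
  have hr1 : s * (n : ℝ) ^ (1 / α) ≤ 1 := by
    have : (n : ℝ) ^ (1 / α) ≤ s⁻¹ := by
      refine (Real.rpow_le_rpow hn0.le hle (by positivity)).trans_eq ?_
      rw [← Real.rpow_mul hs0.le, ← Real.rpow_neg_one]
      congr 1
      field_simp
    calc s * (n : ℝ) ^ (1 / α) ≤ s * s⁻¹ := by gcongr
      _ = 1 := mul_inv_cancel₀ hs0.ne'
  have key := hs (s * (n : ℝ) ^ (1 / α)) ⟨by positivity, hr1⟩
  have harg : (n : ℝ) ^ (-(1 / α)) * (s * (n : ℝ) ^ (1 / α)) = s := by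
    rw [mul_left_comm, ← Real.rpow_add hn0]; simp
  have hrα : (s * (n : ℝ) ^ (1 / α)) ^ α = n * s ^ α := by
    rw [Real.mul_rpow hs0.le (by positivity), ← Real.rpow_mul hn0.le,
      one_div_mul_cancel hα.ne', Real.rpow_one, mul_comm]
  rw [harg, hrα] at key
  have hhalf : 1 ≤ 2 * (n * s ^ α) := by nlinarith
  have hne : ((s ^ α : ℝ) : ℂ) ≠ 0 := by exact_mod_cast hsα.ne'
  have heq : n * Complex.log (φ s) + c * ((n * s ^ α : ℝ) : ℂ)
      = ((n * s ^ α : ℝ) : ℂ) * (Complex.log (φ s) / ((s ^ α : ℝ) : ℂ) - -c) := by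
    push_cast
    field_simp
    ring
  rw [heq, norm_mul, Complex.norm_real, Real.norm_of_nonneg (by positivity)] at key
  rw [dist_eq_norm]
  have := min_le_left (ε / 8) (1 / 8)
  nlinarith [norm_nonneg (Complex.log (φ s) / ((s ^ α : ℝ) : ℂ) - -c)]

lemma tendsto_sub_one_div_of_tendsto_log_div {φ : ℝ → ℂ} (hφ : Continuous φ) (hφ0 : φ 0 = 1)
    {g : ℝ → ℂ} {c : ℂ} {l : Filter ℝ} (hl : l ≤ 𝓝 0)
    (h : Tendsto (fun s ↦ Complex.log (φ s) / g s) l (𝓝 c)) :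
    Tendsto (fun s ↦ (φ s - 1) / g s) l (𝓝 c) := by
  have hφl : Tendsto φ l (𝓝 1) := hφ0 ▸ (hφ.tendsto 0).mono_left hl
  have hlog : Tendsto (fun s ↦ Complex.log (φ s)) l (𝓝 0) := by
    simpa using hφl.clog (by simp)
  -- With `z = log φ s`, the remainder `exp z - 1 - z` is at most `‖z‖ ^ 2`, hence `o(g s)`.
  have hrem : Tendsto (fun s ↦ (φ s - 1 - Complex.log (φ s)) / g s) l (𝓝 0) := by
    refine squeeze_zero_norm' (a := fun s ↦ ‖Complex.log (φ s)‖ * ‖Complex.log (φ s) / g s‖) ?_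
      (by simpa using hlog.norm.mul h.norm)
    filter_upwards [hlog.norm.eventually_le_const (u := 1) (by simp),
      hφl.eventually_ne one_ne_zero] with s hs hs0
    have := Complex.norm_exp_sub_one_sub_id_le hs
    rw [Complex.exp_log hs0] at this
    rw [norm_div, norm_div, ← mul_div_assoc, ← sq]
    gcongr
  simpa [← add_div] using hrem.add h

/-- The expansion at `0+` bounds `φ - 1` by a multiple of `s ^ α` near `0`; away from `0` the bound
`‖φ - 1‖ ≤ 2` suffices. -/
lemma exists_norm_sub_one_le_mul_rpow {φ : ℝ → ℂ} (hφ1 : ∀ s, ‖φ s‖ ≤ 1) (hφ0 : φ 0 = 1)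
    {α : ℝ} (hα : 0 < α) {c : ℂ}
    (h : Tendsto (fun s ↦ (φ s - 1) / ((s ^ α : ℝ) : ℂ)) (𝓝[>] 0) (𝓝 c)) :
    ∃ C : ℝ, ∀ s : ℝ, 0 ≤ s → ‖φ s - 1‖ ≤ C * s ^ α := by
  have hev := h.norm.eventually_lt_const (lt_add_one ‖c‖)
  obtain ⟨δ, hδ, hball⟩ := mem_nhdsGT_iff_exists_Ioo_subset.1 hev
  replace hδ : 0 < δ := hδ
  refine ⟨max (‖c‖ + 1) (2 / δ ^ α), fun s hs ↦ ?_⟩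
  rcases hs.eq_or_lt with rfl | hs0
  · simp [hφ0, Real.zero_rpow hα.ne']
  have hsα : 0 < s ^ α := by positivity
  rw [← div_le_iff₀ hsα]
  rcases lt_or_ge s δ with hsδ | hsδ
  · have : ‖(φ s - 1) / ((s ^ α : ℝ) : ℂ)‖ < ‖c‖ + 1 := hball ⟨hs0, hsδ⟩
    rw [norm_div, Complex.norm_real, Real.norm_of_nonneg hsα.le] at this
    exact this.le.trans (le_max_left _ _)
  · refine le_trans ?_ (le_max_right _ _)
    have : ‖φ s - 1‖ ≤ 2 := (norm_sub_le _ _).trans (by simpa using by linarith [hφ1 s])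
    gcongr

/-- If `φ s = 1 + c s ^ α + o(s ^ α)`, then mixing over the scale `Y` multiplies the exponent of the
limit of `φ (n ^ (-1/α) t) ^ n` by `E Y ^ α`. -/
lemma tendsto_pow_integral_of_tendsto_sub_one_div {φ : ℝ → ℂ} (hφ : Continuous φ)
    (hφ1 : ∀ s, ‖φ s‖ ≤ 1) (hφ0 : φ 0 = 1) {α : ℝ} (hα : 0 < α) {c : ℂ}
    (h : Tendsto (fun s ↦ (φ s - 1) / ((s ^ α : ℝ) : ℂ)) (𝓝[>] 0) (𝓝 c))
    {Ω : Type*} [MeasurableSpace Ω] {P : Measure Ω} [IsProbabilityMeasure P] {Y : Ω → ℝ}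
    (mY : AEMeasurable Y P) (hY : ∀ᵐ ω ∂P, 0 ≤ Y ω) (hYα : Integrable (fun ω ↦ Y ω ^ α) P)
    {t : ℝ} (ht : 0 ≤ t) :
    Tendsto (fun n : ℕ ↦ (∫ ω, φ ((n : ℝ) ^ (-(1 / α)) * t * Y ω) ∂P) ^ n) atTop
      (𝓝 (Complex.exp (c * (((∫ ω, Y ω ^ α ∂P) * t ^ α : ℝ) : ℂ)))) := by
  obtain ⟨C, hC⟩ := exists_norm_sub_one_le_mul_rpow hφ1 hφ0 hα h
  have hscale : ∀ (n : ℕ) (u : ℝ), 1 ≤ n → 0 ≤ u → ((n : ℝ) ^ (-(1 / α)) * u) ^ α = u ^ α / n := by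
    intro n u hn hu
    rw [Real.mul_rpow (by positivity) hu, ← Real.rpow_mul (by positivity), neg_mul,
      one_div_mul_cancel hα.ne', Real.rpow_neg_one]
    ring
  have hsmall : Tendsto (fun n : ℕ ↦ (n : ℝ) ^ (-(1 / α))) atTop (𝓝 0) :=
    (tendsto_rpow_neg_atTop (by positivity)).comp tendsto_natCast_atTop_atTop
  have hpt : ∀ u : ℝ, 0 ≤ u → Tendsto (fun n : ℕ ↦ (n : ℂ) * (φ ((n : ℝ) ^ (-(1 / α)) * u) - 1))
      atTop (𝓝 (c * ((u ^ α : ℝ) : ℂ))) := by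
    intro u hu
    rcases hu.eq_or_lt with rfl | hu0
    · simp [hφ0, Real.zero_rpow hα.ne']
    have harg : Tendsto (fun n : ℕ ↦ (n : ℝ) ^ (-(1 / α)) * u) atTop (𝓝[>] 0) := by
      refine tendsto_nhdsWithin_iff.2 ⟨by simpa using hsmall.mul_const u, ?_⟩
      filter_upwards [eventually_ge_atTop 1] with n hn
      have : (0 : ℝ) < n := by exact_mod_cast hn
      exact Set.mem_Ioi.2 (by positivity)
    refine ((h.comp harg).mul_const _).congr' ?_
    filter_upwards [eventually_ge_atTop 1] with n hn
    have hn0 : (n : ℂ) ≠ 0 := by exact_mod_cast (by lia : n ≠ 0)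
    have hu1 : ((u ^ α : ℝ) : ℂ) ≠ 0 := by exact_mod_cast (by positivity : u ^ α ≠ 0)
    simp only [Function.comp_apply, hscale n u hn hu]
    push_cast
    field_simp
  have hint : ∀ r : ℝ, Integrable (fun ω ↦ φ (r * Y ω)) P := fun r ↦
    Integrable.of_bound (C := 1) (hφ.comp_aestronglyMeasurable (mY.const_mul r).aestronglyMeasurable)
      (ae_of_all _ fun _ ↦ hφ1 _)
  have hdom : Tendsto
      (fun n : ℕ ↦ ∫ ω, (n : ℂ) * (φ ((n : ℝ) ^ (-(1 / α)) * t * Y ω) - 1) ∂P) atTop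
      (𝓝 (∫ ω, c * (((t * Y ω) ^ α : ℝ) : ℂ) ∂P)) := by
    refine tendsto_integral_filter_of_dominated_convergence (fun ω ↦ C * t ^ α * Y ω ^ α)
      (.of_forall fun n ↦ (((hint _).sub (integrable_const 1)).const_mul _).aestronglyMeasurable)
      ?_ (hYα.const_mul _) ?_
    · filter_upwards [eventually_ge_atTop 1] with n hn
      filter_upwards [hY] with ω hω
      have hn0 : (0 : ℝ) < n := by exact_mod_cast hn
      have htY : 0 ≤ t * Y ω := mul_nonneg ht hω
      have := hC ((n : ℝ) ^ (-(1 / α)) * (t * Y ω)) (by positivity)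
      rw [hscale n _ hn htY, Real.mul_rpow ht hω, ← mul_assoc] at this
      rw [norm_mul, Complex.norm_natCast]
      calc n * ‖φ ((n : ℝ) ^ (-(1 / α)) * t * Y ω) - 1‖
          ≤ n * (C * (t ^ α * Y ω ^ α / n)) := by
            gcongr
        _ = C * t ^ α * Y ω ^ α := by field_simp
    · filter_upwards [hY] with ω hω
      simpa only [mul_assoc] using hpt (t * Y ω) (mul_nonneg ht hω)
  have hlim : ∫ ω, c * (((t * Y ω) ^ α : ℝ) : ℂ) ∂P
      = c * (((∫ ω, Y ω ^ α ∂P) * t ^ α : ℝ) : ℂ) := by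
    rw [integral_const_mul, integral_complex_ofReal, ← integral_mul_const]
    congr 2
    refine integral_congr_ae ?_
    filter_upwards [hY] with ω hω
    rw [Real.mul_rpow ht hω, mul_comm]
  rw [hlim] at hdom
  refine (Complex.tendsto_one_add_pow_exp_of_tendsto (g := fun n : ℕ ↦
    (∫ ω, φ ((n : ℝ) ^ (-(1 / α)) * t * Y ω) ∂P) - 1) (hdom.congr fun n ↦ ?_)).congr fun n ↦ ?_
  · rw [integral_const_mul, integral_sub (hint _) (integrable_const 1)]
    simp
  · simp

/-! ### The limit theorem -/

lemma ProbabilityTheory.iIndepFun.charFun_mul_sum {Ω : Type*} [MeasurableSpace Ω] {P : Measure Ω}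
    {X : ℕ → Ω → ℝ} (hX : iIndepFun X P) (hid : ∀ i, IdentDistrib (X i) (X 0) P P) (n : ℕ)
    (a t : ℝ) :
    charFun (P.map fun ω ↦ a * ∑ i ∈ Finset.range n, X i ω) t
      = charFun (P.map (X 0)) (a * t) ^ n := by
  have mX n := (hid n).aemeasurable_fst
  rw [charFun_map_mul_comp (Finset.aemeasurable_fun_sum _ fun _ _ ↦ mX _),
    (hX.restrict _).charFun_map_fun_finsetSum_eq_prod (fun _ _ ↦ mX _)]
  simp [fun i ↦ (hid i).map_eq]

/-- Lévy's theorem on `ℝ`, checked only at `t ≥ 0`: conjugation gives the other half-line. -/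
lemma tendstoInDistribution_of_tendsto_charFun_of_nonneg {Ω Ω' : Type*} [MeasurableSpace Ω]
    [MeasurableSpace Ω'] {P : Measure Ω} [IsProbabilityMeasure P] {P' : Measure Ω'}
    [IsProbabilityMeasure P'] {S : ℕ → Ω → ℝ} {Z : Ω' → ℝ} (mS : ∀ n, AEMeasurable (S n) P)
    (mZ : AEMeasurable Z P')
    (h : ∀ t : ℝ, 0 ≤ t →
      Tendsto (fun n ↦ charFun (P.map (S n)) t) atTop (𝓝 (charFun (P'.map Z) t))) :
    TendstoInDistribution S atTop Z (fun _ ↦ P) P' where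
  forall_aemeasurable := mS
  aemeasurable_limit := mZ
  tendsto := by
    refine ProbabilityMeasure.tendsto_of_tendsto_charFun fun t ↦ ?_
    rcases le_total 0 t with ht | ht
    · exact h t ht
    · have := (Complex.continuous_conj.tendsto _).comp (h (-t) (neg_nonneg.2 ht))
      simpa [Function.comp_def, charFun_neg] using this

/-- For `α = 1` a nonzero skewness would produce a drift `log a` under scaling, hence the condition
on `β`. -/
lemma stableCharFun_const_mul {α β a : ℝ} (hα : 0 < α) (hβ : α = 1 → β = 0) (ha : 0 ≤ a) {γ : ℝ}
    (hγ : 0 ≤ γ) (t : ℝ) : stableCharFun α γ β 0 (a * t) = stableCharFun α (a * γ) β 0 t := by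
  unfold stableCharFun
  split_ifs with h1
  · simp [hβ h1, abs_mul, abs_of_nonneg ha, mul_left_comm, mul_assoc]
  · rcases ha.eq_or_lt with rfl | ha0
    · simp [Real.zero_rpow hα.ne']
    · have hsign : Real.sign (a * t) = Real.sign t := by
        rcases lt_trichotomy t 0 with ht | rfl | ht
        · rw [Real.sign_of_neg ht, Real.sign_of_neg (mul_neg_of_pos_of_neg ha0 ht)]
        · simp
        · rw [Real.sign_of_pos ht, Real.sign_of_pos (mul_pos ha0 ht)]
      have hscale : γ ^ α * |a * t| ^ α = (a * γ) ^ α * |t| ^ α := by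
        rw [abs_mul, abs_of_pos ha0, Real.mul_rpow ha (abs_nonneg t), Real.mul_rpow ha hγ]
        ring
      simp only [hsign, hscale, zero_mul]

theorem mainTheorem3
    {Ω Ω' Ω'' : Type*} [MeasurableSpace Ω] [MeasurableSpace Ω'] [MeasurableSpace Ω'']
    (P : Measure Ω) [IsProbabilityMeasure P]
    (P' : Measure Ω') [IsProbabilityMeasure P']
    (P'' : Measure Ω'') [IsProbabilityMeasure P'']
    (α κ lam : ℝ) (hα : 0 < α) (hα2 : α ≤ 2) (hκ : 0 < κ)
    -- `X 0, X 1, …` are i.i.d.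
    (X : ℕ → Ω → ℝ) (hXindep : iIndepFun X P)
    (hXident : ∀ i, IdentDistrib (X i) (X 0) P P)
    -- the limit `Z`, possibly on another probability space
    (Z : Ω' → ℝ)
    (hZ : HasStrictlyStableCharFun α κ lam (P'.map Z))
    (hXZ : TendstoInDistribution
      (fun (n : ℕ) ω ↦ (n : ℝ) ^ (-(1 / α)) * ∑ i ∈ Finset.range n, X i ω)
      atTop Z (fun _ ↦ P) P')
    -- the nonnegative variable `Y` with finite `α`-th moment
    (Y : Ω'' → ℝ) (hYnonneg : ∀ᵐ ω ∂P'', 0 ≤ Y ω)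
    (hYint : Integrable (fun ω ↦ Y ω ^ α) P'')
    -- independent copies of `Y`, independent of the sequence `X`
    (Ys : ℕ → Ω → ℝ) (hYindep : iIndepFun Ys P)
    (hYident : ∀ i, IdentDistrib (Ys i) Y P P'')
    (hXY : IndepFun (fun ω i ↦ X i ω) (fun ω i ↦ Ys i ω) P) :
    TendstoInDistribution
      (fun (n : ℕ) ω ↦ (n : ℝ) ^ (-(1 / α)) * ∑ i ∈ Finset.range n, X i ω * Ys i ω)
      atTop (fun ω ↦ (∫ y, Y y ^ α ∂P'') ^ (1 / α) * Z ω) (fun _ ↦ P) P'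
    ∧ HasStrictlyStableCharFun α ((∫ y, Y y ^ α ∂P'') * κ) ((∫ y, Y y ^ α ∂P'') * lam)
        (P'.map (fun ω ↦ (∫ y, Y y ^ α ∂P'') ^ (1 / α) * Z ω))
    ∧ ∀ γ β : ℝ, (α = 1 → β = 0) → IsStableLaw α γ β 0 (P'.map Z) →
        IsStableLaw α ((∫ y, Y y ^ α ∂P'') ^ (1 / α) * γ) β 0
          (P'.map (fun ω ↦ (∫ y, Y y ^ α ∂P'') ^ (1 / α) * Z ω)) := by
  have mX i : AEMeasurable (X i) P := (hXident i).aemeasurable_fst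
  have mYs i : AEMeasurable (Ys i) P := (hYident i).aemeasurable_fst
  have mY : AEMeasurable Y P'' := (hYident 0).aemeasurable_snd
  have mZ : AEMeasurable Z P' := hXZ.aemeasurable_limit
  have hm : 0 ≤ ∫ y, Y y ^ α ∂P'' :=
    integral_nonneg_of_ae (hYnonneg.mono fun ω hω ↦ Real.rpow_nonneg hω α)
  have ha : 0 ≤ (∫ y, Y y ^ α ∂P'') ^ (1 / α) := by positivity
  have haα : ((∫ y, Y y ^ α ∂P'') ^ (1 / α)) ^ α = ∫ y, Y y ^ α ∂P'' := by
    rw [← Real.rpow_mul hm, one_div_mul_cancel hα.ne', Real.rpow_one]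
  have hZ' : HasStrictlyStableCharFun α ((∫ y, Y y ^ α ∂P'') * κ) ((∫ y, Y y ^ α ∂P'') * lam)
      (P'.map (fun ω ↦ (∫ y, Y y ^ α ∂P'') ^ (1 / α) * Z ω)) := by
    intro t ht
    rw [charFun_map_mul_comp mZ, hZ _ (mul_nonneg ha ht), Real.mul_rpow ha ht, haα]
    push_cast
    congr 1
    ring
  refine ⟨?_, hZ', fun γ β hβ hS ↦ ?_⟩
  · have : IsProbabilityMeasure (P.map (X 0)) := Measure.isProbabilityMeasure_map (mX 0)
    have hφ : Continuous (charFun (P.map (X 0))) := continuous_charFun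
    have hφ0 : charFun (P.map (X 0)) 0 = 1 := by simp
    have hφ1 := norm_charFun_le_one (μ := P.map (X 0))
    have hlog : Tendsto
        (fun s ↦ Complex.log (charFun (P.map (X 0)) s) / ((s ^ α : ℝ) : ℂ)) (𝓝[>] 0)
        (𝓝 (-((κ : ℂ) - Complex.I * (lam : ℂ)))) := by
      refine tendsto_log_div_rpow_of_tendsto_pow hφ hφ0 hα fun t ht ↦ ?_
      rw [← hZ t ht]
      exact (hXZ.tendsto_charFun_prod t).congr fun q ↦ hXindep.charFun_mul_sum hXident _ _ _
    have hasymp := tendsto_sub_one_div_of_tendsto_log_div hφ hφ0 nhdsWithin_le_nhds hlog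
    refine tendstoInDistribution_of_tendsto_charFun_of_nonneg (fun n ↦ by fun_prop) (by fun_prop)
      fun t ht ↦ ?_
    have hlim := tendsto_pow_integral_of_tendsto_sub_one_div hφ hφ1 hφ0 hα hasymp mY hYnonneg
      hYint ht
    rw [hZ' t ht]
    convert! hlim using 2 with n
    · rw [charFun_map_mul_comp (by fun_prop), hXY.charFun_sum_mul hXindep hYindep mX mYs]
      simp only [fun i ↦ (hXident i).map_eq, fun i ↦ (hYident i).map_eq, Finset.prod_const,
        Finset.card_range]
      rw [integral_map mY (by fun_prop)]
    · push_cast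
      congr 1
      ring
  · exact ⟨Measure.isProbabilityMeasure_map (by fun_prop), hS.index_pos, hS.index_le_two,
      mul_nonneg ha hS.scale_nonneg, hS.neg_one_le_skewness, hS.skewness_le_one, fun t ↦ by
        rw [charFun_map_mul_comp mZ, hS.charFun_eq,
          stableCharFun_const_mul hα hβ ha hS.scale_nonneg]⟩
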